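/- Let $X,Y\in\mathbb R^{N\times M}$, $\bar S\in\mathbb R^{N\times N}$, let $\mathcal S\subseteq\mathbb R^{N\times N}$ be closed and convex, and let $\lambda,\beta,\gamma,\delta_1,\delta_2>0$. With $r_\delta(Z)=\sum_{i,j}\log(|Z_{ij}|+\delta)$, consider the problem of minimizing $$f(H,S)=\|Y-HX\|_F^2+\lambda\, r_{\delta_1}(S-\bar S)+\beta\, r_{\delta_2}(S)+\gamma\|SH-HS\|_F^2$$ over $H\in\mathbb R^{N\times N}$, $S\in\mathcal S$. Starting from any $S^{(0)}\in\mathbb R^{N\times N}$ (for instance $\bar S$), let the sequences $H^{(t)},S^{(t)}$ satisfy, for all $t\ge 0$ and with $S=S^{(t)}$ in the first line, $$\mathrm{vec}(H^{(t+1)})=\big(XX^\top\otimes I+\gamma(SS^\top\oplus S^\top S-S^\top\otimes S^\top-S\otimes S)\big)^{-1}(X\otimes I)\,\mathrm{vec}(Y),$$ $$S^{(t+1)}\in\arg\min_{S\in\mathcal S}\ \sum_{i,j}\Big(\frac{\lambda|S_{ij}-\bar S_{ij}|}{|S^{(t)}_{ij}-\bar S_{ij}|+\delta_1}+\frac{\beta|S_{ij}|}{|S^{(t)}_{ij}|+\delta_2}\Big)+\gamma\|SH^{(t+1)}-H^{(t+1)}S\|_F^2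 ,$$ where $A\oplus B=A\otimes I+I\otimes B$ and $H^{(0)}$ is arbitrary. Assume that every $S$ in the closure of $\{S^{(t)}:t\ge0\}$ (that is, every iterate of the graph-shift operator and every limit point of these iterates) (i) is diagonalizable over $\mathbb C$, $S=V\,\mathrm{diag}(\mu)\,V^{-1}$, without repeated eigenvalues, and (ii) is such that every row of $V^{-1}X$ has at least one nonzero entry. Let $\mathcal Z^*$ be the set of the vectors $[\mathrm{vec}(H)^\top,\mathrm{vec}(S)^\top]^\top$ for which $(H,S)$ is a stationary point of $f$ on $\mathbb R^{N\times N}\times\mathcal S$: $S\in\mathcal S$, and for all $D,E\in\mathbb R^{N\times N}$ with $S+E\in\mathcal S$, $\liminf_{s\downarrow0}\big(f(H+sD,S+sE)-f(H,S)\big)/s\ge0$. Let $z^{(t)}=[\mathrm{vec}(H^{(t)})^\top,\mathrm{vec}(S^{(t)})^\top]^\top$. Then $\min_{z^*\in\mathcal Z^*}\|z^{(t)}-z^*\|_2$ exists for every $t$ (in particular $\mathcal Z^*\neq\emptyset$), and $$\lim_{t\to\infty}\ \min_{z^*\in\mathcal Z^*}\|z^{(t)}-z^*\|_2=0 .$$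 -/

import Mathlib

open scoped Matrix Kronecker Topology
open Filter

noncomputable section

namespace RobustGF

/-- Square `N × N` real matrices. -/
abbrev Mat (N : ℕ) : Type := Matrix (Fin N) (Fin N) ℝ

/-- Squared Frobenius norm. -/
def frobSq {m n : ℕ} (A : Matrix (Fin m) (Fin n) ℝ) : ℝ := ∑ i, ∑ j, A i j ^ 2

/-- The logarithmic sparsity penalty `r_δ(Z) = ∑_{i,j} log (|Z_{ij}| + δ)`. -/
def logPenalty {N : ℕ} (δ : ℝ) (Z : Mat N) : ℝ := ∑ i, ∑ j, Real.log (|Z i j| + δ)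

/-- The data of the relaxed problem: input and output signals `X`, `Y`, observed graph-shift
operator `Sbar`, feasible set `feas` of graph-shift operators, and the scalar parameters. -/
structure Problem (N M : ℕ) where
  X : Matrix (Fin N) (Fin M) ℝ
  Y : Matrix (Fin N) (Fin M) ℝ
  Sbar : Mat N
  feas : Set (Mat N)
  lam : ℝ
  bet : ℝ
  gam : ℝ
  δ₁ : ℝ
  δ₂ : ℝ

/-- The standing requirements: positive weights, positive offsets, closed convex feasible set. -/
structure Problem.Admissible {N M : ℕ} (P : Problem N M) : Prop where
  lam_pos : 0 < P.lam
  bet_pos : 0 < P.bet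
  gam_pos : 0 < P.gam
  δ₁_pos : 0 < P.δ₁
  δ₂_pos : 0 < P.δ₂
  feas_closed : IsClosed P.feas
  feas_convex : Convex ℝ P.feas

/-- The objective
`‖Y - HX‖_F² + λ r_{δ₁}(S - Sbar) + β r_{δ₂}(S) + γ ‖SH - HS‖_F²`. -/
def Problem.objective {N M : ℕ} (P : Problem N M) (z : Mat N × Mat N) : ℝ :=
  frobSq (P.Y - z.1 * P.X) + P.lam * logPenalty P.δ₁ (z.2 - P.Sbar)
    + P.bet * logPenalty P.δ₂ z.2 + P.gam * frobSq (z.2 * z.1 - z.1 * z.2)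

/-- The lower one-sided directional derivative `liminf_{s ↓ 0} (f (z + s d) - f z) / s`. -/
def dirDeriv {E : Type*} [AddCommGroup E] [Module ℝ E] (f : E → ℝ) (z d : E) : EReal :=
  liminf (fun s : ℝ => (((f (z + s • d) - f z) / s : ℝ) : EReal)) (𝓝[>] (0 : ℝ))

/-- `z` is a stationary point of `f` on the (convex) set `C`: it is feasible and the directional
derivative of `f` is nonnegative in every feasible direction. -/
def IsStationaryOn {E : Type*} [AddCommGroup E] [Module ℝ E] (f : E → ℝ) (C : Set E) (z : E) :
    Prop :=
  z ∈ C ∧ ∀ d : E, z + d ∈ C → 0 ≤ dirDeriv f z d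

/-- The stacked vector `[vec(H)ᵀ, vec(S)ᵀ]ᵀ`, with the Euclidean norm. -/
def stack {N : ℕ} (H S : Mat N) :
    EuclideanSpace ℝ ((Fin N × Fin N) ⊕ (Fin N × Fin N)) :=
  WithLp.toLp 2 (Sum.elim H.vec S.vec)

/-- The set of stationary points of the objective subject to `S ∈ feas`, in stacked form. -/
def Problem.stationarySet {N M : ℕ} (P : Problem N M) :
    Set (EuclideanSpace ℝ ((Fin N × Fin N) ⊕ (Fin N × Fin N))) :=
  {z | ∃ H S : Mat N, z = stack H S ∧
    IsStationaryOn P.objective (Set.univ ×ˢ P.feas) (H, S)}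

/-- The Kronecker sum `A ⊕ B = A ⊗ I + I ⊗ B`. -/
def kronSum {N : ℕ} (A B : Mat N) : Matrix (Fin N × Fin N) (Fin N × Fin N) ℝ :=
  A ⊗ₖ (1 : Mat N) + (1 : Mat N) ⊗ₖ B

/-- The coefficient matrix of the normal equations of the filter step with the operator `S`
fixed: `XXᵀ ⊗ I + γ (SSᵀ ⊕ SᵀS - Sᵀ ⊗ Sᵀ - S ⊗ S)`. -/
def Problem.normalMatrix {N M : ℕ} (P : Problem N M) (S : Mat N) :
    Matrix (Fin N × Fin N) (Fin N × Fin N) ℝ :=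
  (P.X * P.Xᵀ) ⊗ₖ (1 : Mat N)
    + P.gam • (kronSum (S * Sᵀ) (Sᵀ * S) - Sᵀ ⊗ₖ Sᵀ - S ⊗ₖ S)

/-- The objective of the graph denoising step as a function of `S`, with filter `H` and with
weights computed from the previous operator `S₀`. -/
def Problem.denoisingObjective {N M : ℕ} (P : Problem N M) (H S₀ S : Mat N) : ℝ :=
  (∑ i, ∑ j, (P.lam * (1 / (|S₀ i j - P.Sbar i j| + P.δ₁)) * |S i j - P.Sbar i j|
      + P.bet * (1 / (|S₀ i j| + P.δ₂)) * |S i j|))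
    + P.gam * frobSq (S * H - H * S)

/-- `(H t, S t)` are iterates of the alternating algorithm. The filter step is the closed-form
least-squares solution; the graph step returns any minimizer over the feasible set. The initial
`S 0` is arbitrary and `H 0` plays no role. -/
structure Problem.IsIteration {N M : ℕ} (P : Problem N M) (H S : ℕ → Mat N) : Prop where
  filter_step : ∀ t, (H (t + 1)).vec =
    (P.normalMatrix (S t))⁻¹ *ᵥ ((P.X ⊗ₖ (1 : Mat N)) *ᵥ P.Y.vec)
  graph_step_mem : ∀ t, S (t + 1) ∈ P.feas
  graph_step_min : ∀ t, IsMinOn (P.denoisingObjective (H (t + 1)) (S t)) P.feas (S (t + 1))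

/-- `S = V diag(μ) V⁻¹` with `V` invertible, over `ℂ` (a real operator of a directed graph may
have complex eigenvalues). -/
def IsEigendecomposition {N : ℕ} (S : Mat N) (V : Matrix (Fin N) (Fin N) ℂ) (μ : Fin N → ℂ) :
    Prop :=
  IsUnit V.det ∧ S.map Complex.ofReal = V * Matrix.diagonal μ * V⁻¹

/-- `S` has an eigendecomposition without repeated eigenvalues for which every row of `V⁻¹ X`
has a nonzero entry. -/
def ExcitesSimpleSpectrum {N M : ℕ} (X : Matrix (Fin N) (Fin M) ℝ) (S : Mat N) : Prop :=
  ∃ (V : Matrix (Fin N) (Fin N) ℂ) (μ : Fin N → ℂ), IsEigendecomposition S V μ ∧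
    Function.Injective μ ∧ ∀ i, ∃ m, (V⁻¹ * X.map Complex.ofReal) i m ≠ 0

end RobustGF

end

/-!
The logarithm is concave, so linearizing `log (|·| + δ)` in the variable `|·|` at the current
operator `S₀` bounds the objective from above, and the resulting majorizer is the convex objective
of the graph step (`objective_sub_le`). The error of this linearization is of second order along
rays (`exists_penalty_sub_ge`), and the coupling of the two blocks through the polynomial
commutator term is of second order as well. Hence `(H, S)` is stationary if and only if `H`
minimizes the quadratic filter objective for `S` and `S` minimizes the majorizer built at `S`
itself (`isStationaryOn_iff`). These conditions pass to limits, so the stationary set is closed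
(`isClosed_stationarySet`).

The Hessian of the filter objective is positive definite: if `D X = 0` and `D` commutes with `S`,
then `D` is diagonal in an eigenbasis of `S`, and the excitation condition forces its eigenvalues
to vanish (`ExcitesSimpleSpectrum.eq_zero`). Therefore the closed-form filter is the unique
minimizer, and it depends continuously on `S`.

Both steps decrease the objective from the first computed iterate on, and the logarithmic penalty
is coercive, so the operators stay in a compact set. Along a subsequence three consecutive
operators converge and the objective has the same limit after each of the half-steps between them,
which identifies the limit as a stationary point (`mem_stationarySet_of_tendsto`). Every
subsequence thus has a further subsequence along which the distance to the stationary set tends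
to zero.
-/

namespace RobustGF

/-! ### The Frobenius inner product -/

section Frobenius

variable {l m n : ℕ}

lemma frobSq_eq_dotProduct (A : Matrix (Fin m) (Fin n) ℝ) : frobSq A = A.vec ⬝ᵥ A.vec := by
  simp only [frobSq, dotProduct, Matrix.vec, Fintype.sum_prod_type, sq]
  exact Finset.sum_comm

lemma frobSq_nonneg (A : Matrix (Fin m) (Fin n) ℝ) : 0 ≤ frobSq A :=
  Finset.sum_nonneg fun _ _ => Finset.sum_nonneg fun _ _ => sq_nonneg _

lemma frobSq_eq_zero_iff {A : Matrix (Fin m) (Fin n) ℝ} : frobSq A = 0 ↔ A = 0 := by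
  rw [frobSq_eq_dotProduct, dotProduct_self_eq_zero, Matrix.vec_eq_zero_iff]

lemma frobSq_add (A B : Matrix (Fin m) (Fin n) ℝ) :
    frobSq (A + B) = frobSq A + 2 * (A.vec ⬝ᵥ B.vec) + frobSq B := by
  simp only [frobSq_eq_dotProduct, Matrix.vec_add, add_dotProduct, dotProduct_add,
    dotProduct_comm B.vec A.vec]
  ring

lemma frobSq_smul (s : ℝ) (A : Matrix (Fin m) (Fin n) ℝ) : frobSq (s • A) = s ^ 2 * frobSq A := by
  simp only [frobSq_eq_dotProduct, Matrix.vec_smul, smul_dotProduct, dotProduct_smul, smul_eq_mul]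
  ring

lemma continuous_frobSq : Continuous (frobSq : Matrix (Fin m) (Fin n) ℝ → ℝ) := by
  unfold frobSq
  fun_prop

lemma frobSq_add_smul_sub_le (A B : Matrix (Fin m) (Fin n) ℝ) {s : ℝ} (h0 : 0 ≤ s) (h1 : s ≤ 1) :
    frobSq (A + s • B) - frobSq A ≤ s * (frobSq (A + B) - frobSq A) := by
  rw [frobSq_add, frobSq_add, frobSq_smul, Matrix.vec_smul, dotProduct_smul, smul_eq_mul]
  nlinarith [mul_nonneg (mul_nonneg h0 (sub_nonneg.2 h1)) (frobSq_nonneg B)]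

lemma vec_mul_dotProduct_left (A : Matrix (Fin l) (Fin m) ℝ) (B : Matrix (Fin m) (Fin n) ℝ)
    (C : Matrix (Fin l) (Fin n) ℝ) : (A * B).vec ⬝ᵥ C.vec = B.vec ⬝ᵥ (Aᵀ * C).vec := by
  simp only [Matrix.vec_dotProduct_vec, Matrix.transpose_mul, Matrix.mul_assoc]

lemma vec_mul_dotProduct_right (A : Matrix (Fin l) (Fin m) ℝ) (B : Matrix (Fin m) (Fin n) ℝ)
    (C : Matrix (Fin l) (Fin n) ℝ) : (A * B).vec ⬝ᵥ C.vec = A.vec ⬝ᵥ (C * Bᵀ).vec := by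
  simp only [Matrix.vec_dotProduct_vec, Matrix.transpose_mul]
  rw [Matrix.mul_assoc, Matrix.trace_mul_comm, Matrix.mul_assoc]

/-- The mixed second difference of the squared norm along `s ↦ C + s A + s B + s² F` is of
order `s²`. -/
lemma exists_frobSq_mixed_difference_ge (C A B F : Matrix (Fin m) (Fin n) ℝ) :
    ∃ c : ℝ, ∀ s : ℝ, 0 ≤ s → s ≤ 1 →
      (frobSq (C + s • A) - frobSq C) + (frobSq (C + s • B) - frobSq C) - c * s ^ 2 ≤
        frobSq (C + s • A + s • B + s ^ 2 • F) - frobSq C := by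
  refine ⟨2 * |A.vec ⬝ᵥ B.vec| + 2 * |C.vec ⬝ᵥ F.vec| + 2 * |A.vec ⬝ᵥ F.vec|
    + 2 * |B.vec ⬝ᵥ F.vec|, fun s h0 h1 => ?_⟩
  simp only [frobSq_add, frobSq_smul, Matrix.vec_add, Matrix.vec_smul, add_dotProduct,
    dotProduct_smul, smul_dotProduct, smul_eq_mul]
  have h3 : s ^ 3 ≤ s ^ 2 := pow_le_pow_of_le_one h0 h1 (by norm_num)
  have h30 : 0 ≤ s ^ 3 := by positivity
  have hAF : -(s ^ 2 * |A.vec ⬝ᵥ F.vec|) ≤ s ^ 3 * (A.vec ⬝ᵥ F.vec) := by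
    nlinarith [neg_abs_le (A.vec ⬝ᵥ F.vec), abs_nonneg (A.vec ⬝ᵥ F.vec)]
  have hBF : -(s ^ 2 * |B.vec ⬝ᵥ F.vec|) ≤ s ^ 3 * (B.vec ⬝ᵥ F.vec) := by
    nlinarith [neg_abs_le (B.vec ⬝ᵥ F.vec), abs_nonneg (B.vec ⬝ᵥ F.vec)]
  have hAB := mul_le_mul_of_nonneg_left (neg_abs_le (A.vec ⬝ᵥ B.vec)) (sq_nonneg s)
  have hCF := mul_le_mul_of_nonneg_left (neg_abs_le (C.vec ⬝ᵥ F.vec)) (sq_nonneg s)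
  have hF : 0 ≤ (s ^ 2) ^ 2 * frobSq F := mul_nonneg (by positivity) (frobSq_nonneg F)
  nlinarith

end Frobenius

/-! ### Directional derivatives -/

section DirDeriv

variable {E : Type*} [AddCommGroup E] [Module ℝ E] {f : E → ℝ} {z d : E}

lemma dirDeriv_nonneg_of_quadratic_lower_bound {c : ℝ}
    (h : ∀ s : ℝ, 0 < s → s ≤ 1 → -(c * s ^ 2) ≤ f (z + s • d) - f z) : 0 ≤ dirDeriv f z d := by
  have hlim : Tendsto (fun s : ℝ => ((-(c * s) : ℝ) : EReal)) (𝓝[>] 0) (𝓝 0) := by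
    have h0 : Tendsto (fun s : ℝ => -(c * s)) (𝓝[>] 0) (𝓝 0) := by
      have : Continuous fun s : ℝ => -(c * s) := by fun_prop
      simpa using (this.tendsto 0).mono_left nhdsWithin_le_nhds
    rw [← EReal.coe_zero]
    exact (continuous_coe_real_ereal.tendsto 0).comp h0
  rw [← hlim.liminf_eq]
  refine liminf_le_liminf ?_
  filter_upwards [Ioc_mem_nhdsGT (zero_lt_one' ℝ)] with s hs
  rw [EReal.coe_le_coe_iff, le_div_iff₀ hs.1]
  linarith [h s hs.1 hs.2]

lemma nonneg_of_dirDeriv_nonneg {c : ℝ} (hd : 0 ≤ dirDeriv f z d)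
    (h : ∀ s : ℝ, 0 < s → s ≤ 1 → f (z + s • d) - f z ≤ s * c) : 0 ≤ c := by
  have hle : dirDeriv f z d ≤ liminf (fun _ : ℝ => (c : EReal)) (𝓝[>] (0 : ℝ)) := by
    refine liminf_le_liminf ?_
    filter_upwards [Ioc_mem_nhdsGT (zero_lt_one' ℝ)] with s hs
    rw [EReal.coe_le_coe_iff, div_le_iff₀ hs.1]
    linarith [h s hs.1 hs.2]
  rw [liminf_const] at hle
  exact_mod_cast hd.trans hle

end DirDeriv

/-! ### The reweighted absolute value as a majorizer of the logarithm -/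

lemma log_sub_log_le {δ a b : ℝ} (hδ : 0 < δ) (ha : 0 ≤ a) (hb : 0 ≤ b) :
    Real.log (b + δ) - Real.log (a + δ) ≤ 1 / (a + δ) * b - 1 / (a + δ) * a := by
  have ha' : 0 < a + δ := by linarith
  have hb' : 0 < b + δ := by linarith
  rw [← Real.log_div hb'.ne' ha'.ne']
  refine (Real.log_le_sub_one_of_pos (div_pos hb' ha')).trans (le_of_eq ?_)
  field_simp
  ring

lemma log_sub_log_ge {δ a b : ℝ} (hδ : 0 < δ) (ha : 0 ≤ a) (hb : 0 ≤ b) :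
    1 / (a + δ) * b - 1 / (a + δ) * a - (b - a) ^ 2 / δ ^ 2 ≤
      Real.log (b + δ) - Real.log (a + δ) := by
  have ha' : 0 < a + δ := by linarith
  have hb' : 0 < b + δ := by linarith
  have h1 := log_sub_log_le hδ hb ha
  have h2 : (b - a) ^ 2 / ((a + δ) * (b + δ)) ≤ (b - a) ^ 2 / δ ^ 2 := by
    apply div_le_div_of_nonneg_left (sq_nonneg _) (by positivity)
    nlinarith
  have h3 : 1 / (a + δ) * b - 1 / (a + δ) * a - (b - a) ^ 2 / ((a + δ) * (b + δ)) =
      -(1 / (b + δ) * a - 1 / (b + δ) * b) := by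
    field_simp
    ring
  linarith

namespace Problem

variable {N M : ℕ}

/-- The part of the objective that depends on the filter, with the operator `S` fixed. -/
noncomputable def filterObjective (P : Problem N M) (S H : Mat N) : ℝ :=
  frobSq (P.Y - H * P.X) + P.gam * frobSq (S * H - H * S)

/-- The part of the objective that depends on the operator only. -/
noncomputable def penalty (P : Problem N M) (S : Mat N) : ℝ :=
  ∑ i, ∑ j, (P.lam * Real.log (|S i j - P.Sbar i j| + P.δ₁)
    + P.bet * Real.log (|S i j| + P.δ₂))

/-- The reweighted `ℓ¹` penalty, with weights computed from `S₀`. -/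
noncomputable def weightedPenalty (P : Problem N M) (S₀ S : Mat N) : ℝ :=
  ∑ i, ∑ j, (P.lam * (1 / (|S₀ i j - P.Sbar i j| + P.δ₁)) * |S i j - P.Sbar i j|
      + P.bet * (1 / (|S₀ i j| + P.δ₂)) * |S i j|)

lemma objective_eq (P : Problem N M) (H S : Mat N) :
    P.objective (H, S) = P.filterObjective S H + P.penalty S := by
  simp only [objective, filterObjective, penalty, logPenalty, Finset.sum_add_distrib,
    Finset.mul_sum, Matrix.sub_apply]
  ring

lemma denoisingObjective_eq (P : Problem N M) (H S₀ S : Mat N) :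
    P.denoisingObjective H S₀ S = P.weightedPenalty S₀ S + P.gam * frobSq (S * H - H * S) := rfl

lemma penalty_sub_le {P : Problem N M} (hP : P.Admissible) (S T : Mat N) :
    P.penalty T - P.penalty S ≤ P.weightedPenalty S T - P.weightedPenalty S S := by
  simp only [penalty, weightedPenalty, ← Finset.sum_sub_distrib]
  refine Finset.sum_le_sum fun i _ => Finset.sum_le_sum fun j _ => ?_
  have h1 := mul_le_mul_of_nonneg_left
    (log_sub_log_le hP.δ₁_pos (abs_nonneg (S i j - P.Sbar i j)) (abs_nonneg (T i j - P.Sbar i j)))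
    hP.lam_pos.le
  have h2 := mul_le_mul_of_nonneg_left
    (log_sub_log_le hP.δ₂_pos (abs_nonneg (S i j)) (abs_nonneg (T i j))) hP.bet_pos.le
  linarith

lemma objective_sub_le {P : Problem N M} (hP : P.Admissible) (H S T : Mat N) :
    P.objective (H, T) - P.objective (H, S) ≤
      P.denoisingObjective H S T - P.denoisingObjective H S S := by
  have := penalty_sub_le hP S T
  simp only [objective_eq, denoisingObjective_eq, filterObjective]
  linarith

/-- The majorizer is tangent to the penalty to second order along every ray. -/
lemma exists_penalty_sub_ge {P : Problem N M} (hP : P.Admissible) (S E : Mat N) :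
    ∃ c : ℝ, ∀ s : ℝ,
      P.weightedPenalty S (S + s • E) - P.weightedPenalty S S - c * s ^ 2 ≤
        P.penalty (S + s • E) - P.penalty S := by
  refine ⟨∑ i, ∑ j, (P.lam * (E i j ^ 2 / P.δ₁ ^ 2) + P.bet * (E i j ^ 2 / P.δ₂ ^ 2)),
    fun s => ?_⟩
  simp only [penalty, weightedPenalty, Finset.sum_mul, ← Finset.sum_sub_distrib]
  refine Finset.sum_le_sum fun i _ => Finset.sum_le_sum fun j _ => ?_
  have key : ∀ (δ w x y : ℝ), 0 < δ → 0 ≤ w → x - y = s * E i j →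
      w * (1 / (|y| + δ)) * |x| - w * (1 / (|y| + δ)) * |y| - w * (E i j ^ 2 / δ ^ 2) * s ^ 2 ≤
        w * Real.log (|x| + δ) - w * Real.log (|y| + δ) := by
    intro δ w x y hδ hw hxy
    have hsq : (|x| - |y|) ^ 2 ≤ (s * E i j) ^ 2 := by
      rw [← hxy]
      exact sq_le_sq.2 (abs_abs_sub_abs_le x y)
    have h1 := mul_le_mul_of_nonneg_left
      (log_sub_log_ge hδ (abs_nonneg y) (abs_nonneg x)) hw
    have h2 := mul_le_mul_of_nonneg_left
      (div_le_div_of_nonneg_right hsq (sq_nonneg δ)) hw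
    have h3 : w * ((s * E i j) ^ 2 / δ ^ 2) = w * (E i j ^ 2 / δ ^ 2) * s ^ 2 := by ring
    linarith
  have h1 := key P.δ₁ P.lam ((S + s • E) i j - P.Sbar i j) (S i j - P.Sbar i j) hP.δ₁_pos
    hP.lam_pos.le (by simp)
  have h2 := key P.δ₂ P.bet ((S + s • E) i j) (S i j) hP.δ₂_pos hP.bet_pos.le (by simp)
  linarith

lemma weightedPenalty_add_smul_sub_le {P : Problem N M} (hP : P.Admissible) (S₀ S E : Mat N)
    {s : ℝ} (h0 : 0 ≤ s) (h1 : s ≤ 1) :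
    P.weightedPenalty S₀ (S + s • E) - P.weightedPenalty S₀ S ≤
      s * (P.weightedPenalty S₀ (S + E) - P.weightedPenalty S₀ S) := by
  simp only [weightedPenalty, ← Finset.sum_sub_distrib, Finset.mul_sum]
  refine Finset.sum_le_sum fun i _ => Finset.sum_le_sum fun j _ => ?_
  have key : ∀ (w x y z : ℝ), 0 ≤ w → z = (1 - s) * x + s * y →
      w * |z| - w * |x| ≤ s * (w * |y| - w * |x|) := by
    intro w x y z hw hz
    have : |z| ≤ (1 - s) * |x| + s * |y| := by
      rw [hz]
      refine (abs_add_le _ _).trans (le_of_eq ?_)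
      rw [abs_mul, abs_mul, abs_of_nonneg h0, abs_of_nonneg (sub_nonneg.2 h1)]
    nlinarith
  have w1 : 0 ≤ P.lam * (1 / (|S₀ i j - P.Sbar i j| + P.δ₁)) := by
    have := hP.lam_pos; have := hP.δ₁_pos; positivity
  have w2 : 0 ≤ P.bet * (1 / (|S₀ i j| + P.δ₂)) := by
    have := hP.bet_pos; have := hP.δ₂_pos; positivity
  have e1 := key _ (S i j - P.Sbar i j) ((S + E) i j - P.Sbar i j)
    ((S + s • E) i j - P.Sbar i j) w1 (by simp; ring)
  have e2 := key _ (S i j) ((S + E) i j) ((S + s • E) i j) w2 (by simp; ring)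
  linarith

lemma denoisingObjective_add_smul_sub_le {P : Problem N M} (hP : P.Admissible) (H S₀ S E : Mat N)
    {s : ℝ} (h0 : 0 ≤ s) (h1 : s ≤ 1) :
    P.denoisingObjective H S₀ (S + s • E) - P.denoisingObjective H S₀ S ≤
      s * (P.denoisingObjective H S₀ (S + E) - P.denoisingObjective H S₀ S) := by
  have hw := weightedPenalty_add_smul_sub_le hP S₀ S E h0 h1
  have hc := mul_le_mul_of_nonneg_left
    (frobSq_add_smul_sub_le (S * H - H * S) (E * H - H * E) h0 h1) hP.gam_pos.le
  have e1 : (S + s • E) * H - H * (S + s • E) = S * H - H * S + s • (E * H - H * E) := by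
    simp only [add_mul, mul_add, smul_mul_assoc, mul_smul_comm, smul_sub]; abel
  have e2 : (S + E) * H - H * (S + E) = S * H - H * S + (E * H - H * E) := by
    simp only [add_mul, mul_add]; abel
  simp only [denoisingObjective_eq, e1, e2]
  linarith

lemma filterObjective_add_smul_sub_le {P : Problem N M} (hP : P.Admissible) (S H D : Mat N)
    {s : ℝ} (h0 : 0 ≤ s) (h1 : s ≤ 1) :
    P.filterObjective S (H + s • D) - P.filterObjective S H ≤
      s * (P.filterObjective S (H + D) - P.filterObjective S H) := by
  have hr := frobSq_add_smul_sub_le (P.Y - H * P.X) (-(D * P.X)) h0 h1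
  have hc := mul_le_mul_of_nonneg_left
    (frobSq_add_smul_sub_le (S * H - H * S) (S * D - D * S) h0 h1) hP.gam_pos.le
  have e1 : S * (H + s • D) - (H + s • D) * S = S * H - H * S + s • (S * D - D * S) := by
    simp only [add_mul, mul_add, smul_mul_assoc, mul_smul_comm, smul_sub]; abel
  have e2 : S * (H + D) - (H + D) * S = S * H - H * S + (S * D - D * S) := by
    simp only [add_mul, mul_add]; abel
  have e3 : P.Y - (H + s • D) * P.X = P.Y - H * P.X + s • (-(D * P.X)) := by
    simp only [Matrix.add_mul, Matrix.smul_mul, smul_neg]; abel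
  have e4 : P.Y - (H + D) * P.X = P.Y - H * P.X + -(D * P.X) := by
    simp only [Matrix.add_mul]; abel
  simp only [filterObjective, e1, e2, e3, e4]
  linarith

/-! ### Stationary points -/

/-- Up to second order along a ray, the objective decomposes into the filter part and the
majorizer of the operator part. -/
lemma exists_objective_sub_ge {P : Problem N M} (hP : P.Admissible) (H S D E : Mat N) :
    ∃ c : ℝ, ∀ s : ℝ, 0 ≤ s → s ≤ 1 →
      (P.filterObjective S (H + s • D) - P.filterObjective S H)
        + (P.denoisingObjective H S (S + s • E) - P.denoisingObjective H S S) - c * s ^ 2 ≤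
        P.objective (H + s • D, S + s • E) - P.objective (H, S) := by
  obtain ⟨c₁, h₁⟩ := exists_frobSq_mixed_difference_ge (S * H - H * S) (S * D - D * S)
    (E * H - H * E) (E * D - D * E)
  obtain ⟨c₂, h₂⟩ := exists_penalty_sub_ge hP S E
  refine ⟨P.gam * c₁ + c₂, fun s hs0 hs1 => ?_⟩
  have e1 : (S + s • E) * (H + s • D) - (H + s • D) * (S + s • E) =
      S * H - H * S + s • (S * D - D * S) + s • (E * H - H * E) + s ^ 2 • (E * D - D * E) := by
    simp only [add_mul, mul_add, smul_mul_assoc, mul_smul_comm, smul_sub, smul_add, smul_smul, sq]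
    abel
  have e2 : S * (H + s • D) - (H + s • D) * S = S * H - H * S + s • (S * D - D * S) := by
    simp only [add_mul, mul_add, smul_mul_assoc, mul_smul_comm, smul_sub]; abel
  have e3 : (S + s • E) * H - H * (S + s • E) = S * H - H * S + s • (E * H - H * E) := by
    simp only [add_mul, mul_add, smul_mul_assoc, mul_smul_comm, smul_sub]; abel
  have h1 := mul_le_mul_of_nonneg_left (h₁ s hs0 hs1) hP.gam_pos.le
  have h2 := h₂ s
  simp only [objective_eq, filterObjective, denoisingObjective_eq, e1, e2, e3]
  linarith

/-- Stationarity means that each block solves its own convex subproblem: the filter minimizes the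
quadratic filter objective, and the operator minimizes the convex majorizer built at that very
operator. -/
theorem isStationaryOn_iff {P : Problem N M} (hP : P.Admissible) (H S : Mat N) :
    IsStationaryOn P.objective (Set.univ ×ˢ P.feas) (H, S) ↔
      S ∈ P.feas ∧ (∀ H', P.filterObjective S H ≤ P.filterObjective S H') ∧
        ∀ T ∈ P.feas, P.denoisingObjective H S S ≤ P.denoisingObjective H S T := by
  constructor
  · rintro ⟨hmem, hst⟩
    have hS : S ∈ P.feas := hmem.2
    refine ⟨hS, fun H' => ?_, fun T hT => ?_⟩
    · refine sub_nonneg.1 (nonneg_of_dirDeriv_nonneg (hst (H' - H, 0) ⟨trivial, by simpa using hS⟩)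
        fun s h0 h1 => ?_)
      have := filterObjective_add_smul_sub_le hP S H (H' - H) h0.le h1
      simpa [objective_eq] using this
    · refine sub_nonneg.1 (nonneg_of_dirDeriv_nonneg (hst (0, T - S) ⟨trivial, by simpa using hT⟩)
        fun s h0 h1 => ?_)
      have h2 := denoisingObjective_add_smul_sub_le hP H S S (T - S) h0.le h1
      have h3 := objective_sub_le hP H S (S + s • (T - S))
      rw [add_sub_cancel] at h2
      simpa using h3.trans h2
  · rintro ⟨hS, hH, hT⟩
    refine ⟨⟨trivial, hS⟩, fun d hd => ?_⟩
    obtain ⟨c, hc⟩ := exists_objective_sub_ge hP H S d.1 d.2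
    refine dirDeriv_nonneg_of_quadratic_lower_bound (c := c) fun s h0 h1 => ?_
    have h3 := hc s h0.le h1
    have h4 := hH (H + s • d.1)
    have h5 := hT (S + s • d.2) (hP.feas_convex.add_smul_mem hS hd.2 ⟨h0.le, h1⟩)
    have h6 : ((H, S) : Mat N × Mat N) + s • d = (H + s • d.1, S + s • d.2) := rfl
    rw [h6]
    linarith

end Problem
end RobustGF

namespace RobustGF
namespace Problem

variable {N M : ℕ}

/-! ### The normal equations of the filter step -/

lemma normalMatrix_mulVec_vec (P : Problem N M) (S H : Mat N) :
    P.normalMatrix S *ᵥ H.vec =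
      (H * P.X * P.Xᵀ + P.gam • (Sᵀ * (S * H - H * S) - (S * H - H * S) * Sᵀ)).vec := by
  simp only [normalMatrix, kronSum, Matrix.add_mulVec, Matrix.smul_mulVec, Matrix.sub_mulVec,
    Matrix.kronecker_mulVec_vec, ← Matrix.vec_add, ← Matrix.vec_sub, ← Matrix.vec_smul,
    Matrix.transpose_mul, Matrix.transpose_transpose, Matrix.transpose_one, one_mul, mul_one]
  congr 2
  · simp only [Matrix.mul_assoc]
  · congr 1
    simp only [mul_sub, sub_mul, mul_assoc]
    abel

lemma dotProduct_normalMatrix_mulVec (P : Problem N M) (S D H : Mat N) :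
    D.vec ⬝ᵥ (P.normalMatrix S *ᵥ H.vec) = (D * P.X).vec ⬝ᵥ (H * P.X).vec
      + P.gam * ((S * D - D * S).vec ⬝ᵥ (S * H - H * S).vec) := by
  rw [normalMatrix_mulVec_vec, vec_mul_dotProduct_right, Matrix.vec_sub (S * D), sub_dotProduct,
    vec_mul_dotProduct_left, vec_mul_dotProduct_right, Matrix.vec_add, Matrix.vec_smul,
    Matrix.vec_sub, dotProduct_add, dotProduct_smul, dotProduct_sub, smul_eq_mul]

/-- The filter objective is quadratic with Hessian `2 • normalMatrix S`. -/
lemma filterObjective_add (P : Problem N M) (S H D : Mat N) :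
    P.filterObjective S (H + D) = P.filterObjective S H
      + 2 * (D.vec ⬝ᵥ (P.normalMatrix S *ᵥ H.vec - (P.X ⊗ₖ (1 : Mat N)) *ᵥ P.Y.vec))
      + (frobSq (D * P.X) + P.gam * frobSq (S * D - D * S)) := by
  have e1 : P.Y - (H + D) * P.X = P.Y - H * P.X + -(D * P.X) := by
    simp only [Matrix.add_mul]; abel
  have e2 : S * (H + D) - (H + D) * S = S * H - H * S + (S * D - D * S) := by
    simp only [add_mul, mul_add]; abel
  have e3 : (P.X ⊗ₖ (1 : Mat N)) *ᵥ P.Y.vec = (P.Y * P.Xᵀ).vec := by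
    rw [Matrix.kronecker_mulVec_vec, Matrix.one_mul]
  have e4 : frobSq (-(D * P.X)) = frobSq (D * P.X) := by
    simpa using frobSq_smul (-1) (D * P.X)
  rw [dotProduct_sub, dotProduct_normalMatrix_mulVec, e3, ← vec_mul_dotProduct_right]
  simp only [filterObjective, e1, e2, frobSq_add, e4, Matrix.vec_sub P.Y, Matrix.vec_neg,
    sub_dotProduct, dotProduct_neg]
  rw [dotProduct_comm P.Y.vec, dotProduct_comm (H * P.X).vec, dotProduct_comm (S * H - H * S).vec]
  ring

end Problem

/-- A matrix commuting with `S` is diagonal in an eigenbasis of `S` with simple spectrum. Its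
eigenvalues multiply the rows of `V⁻¹ X`, none of which vanishes, so it is zero as soon as it
annihilates `X`. -/
lemma ExcitesSimpleSpectrum.eq_zero {N M : ℕ} {X : Matrix (Fin N) (Fin M) ℝ} {S D : Mat N}
    (h : ExcitesSimpleSpectrum X S) (hX : D * X = 0) (hS : S * D = D * S) : D = 0 := by
  obtain ⟨V, μ, ⟨hV, hdec⟩, hμ, hrow⟩ := h
  have hVV : V * V⁻¹ = 1 := Matrix.mul_nonsing_inv V hV
  have hVV' : V⁻¹ * V = 1 := Matrix.nonsing_inv_mul V hV
  set Sc : Matrix (Fin N) (Fin N) ℂ := S.map Complex.ofReal with hSc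
  set Dc : Matrix (Fin N) (Fin N) ℂ := D.map Complex.ofReal with hDc
  set Xc : Matrix (Fin N) (Fin M) ℂ := X.map Complex.ofReal with hXc
  have hcomm : Sc * Dc = Dc * Sc := by
    have := congrArg (fun A : Mat N => A.map Complex.ofRealHom) hS
    simp only [Matrix.map_mul] at this
    exact this
  have hDX : Dc * Xc = 0 := by
    have := congrArg (fun A : Matrix (Fin N) (Fin M) ℝ => A.map Complex.ofRealHom) hX
    simp only [Matrix.map_mul] at this
    refine this.trans ?_
    ext i j
    simp
  set W := V⁻¹ * Dc * V with hW
  have hVS : V⁻¹ * Sc = Matrix.diagonal μ * V⁻¹ := by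
    rw [hdec, ← mul_assoc, ← mul_assoc, hVV', one_mul]
  have hSV : Sc * V = V * Matrix.diagonal μ := by
    rw [hdec, mul_assoc, hVV', mul_one]
  have hWcomm : Matrix.diagonal μ * W = W * Matrix.diagonal μ := by
    calc Matrix.diagonal μ * W = (Matrix.diagonal μ * V⁻¹) * Dc * V := by
          simp only [hW, mul_assoc]
      _ = V⁻¹ * (Sc * Dc) * V := by rw [← hVS]; simp only [mul_assoc]
      _ = V⁻¹ * Dc * (Sc * V) := by rw [hcomm]; simp only [mul_assoc]
      _ = W * Matrix.diagonal μ := by rw [hSV]; simp only [hW, mul_assoc]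
  have hoff : ∀ i j, i ≠ j → W i j = 0 := by
    intro i j hij
    have hent := congrFun (congrFun hWcomm i) j
    rw [Matrix.diagonal_mul, Matrix.mul_diagonal, mul_comm (W i j)] at hent
    have h0 : (μ i - μ j) * W i j = 0 := by rw [sub_mul, hent, sub_self]
    exact (mul_eq_zero.1 h0).resolve_left (sub_ne_zero.2 fun he => hij (hμ he))
  have hWX : W * (V⁻¹ * Xc) = 0 := by
    have hassoc : W * (V⁻¹ * Xc) = V⁻¹ * (Dc * ((V * V⁻¹) * Xc)) := by
      simp only [hW, Matrix.mul_assoc]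
    rw [hassoc, hVV, Matrix.one_mul, hDX, Matrix.mul_zero]
  have hWzero : W = 0 := by
    ext i j
    by_cases hij : i = j
    · subst hij
      obtain ⟨m, hm⟩ := hrow i
      have hent := congrFun (congrFun hWX i) m
      rw [Matrix.mul_apply, Finset.sum_eq_single i (fun k _ hk => by rw [hoff i k hk.symm, zero_mul])
        (fun hi => absurd (Finset.mem_univ i) hi)] at hent
      exact (mul_eq_zero.1 hent).resolve_right hm
    · exact hoff i j hij
  have hDzero : Dc = 0 := by
    have : Dc = V * W * V⁻¹ := by
      calc Dc = (V * V⁻¹) * Dc * (V * V⁻¹) := by rw [hVV, one_mul, mul_one]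
        _ = V * W * V⁻¹ := by simp only [hW, mul_assoc]
    rw [this, hWzero, mul_zero, zero_mul]
  ext i j
  exact Complex.ofReal_eq_zero.1 (congrFun (congrFun hDzero i) j)

namespace Problem

variable {N M : ℕ}

lemma eq_zero_of_quadratic_eq_zero {P : Problem N M} (hP : P.Admissible) {S D : Mat N}
    (hS : ExcitesSimpleSpectrum P.X S)
    (h : frobSq (D * P.X) + P.gam * frobSq (S * D - D * S) = 0) : D = 0 := by
  have h1 := frobSq_nonneg (D * P.X)
  have h2 := mul_nonneg hP.gam_pos.le (frobSq_nonneg (S * D - D * S))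
  have h3 : P.gam * frobSq (S * D - D * S) = 0 := by linarith
  refine hS.eq_zero (frobSq_eq_zero_iff.1 (by linarith)) (sub_eq_zero.1 (frobSq_eq_zero_iff.1 ?_))
  exact (mul_eq_zero.1 h3).resolve_left hP.gam_pos.ne'

lemma isUnit_det_normalMatrix {P : Problem N M} (hP : P.Admissible) {S : Mat N}
    (hS : ExcitesSimpleSpectrum P.X S) : IsUnit (P.normalMatrix S).det := by
  rw [isUnit_iff_ne_zero]
  intro hdet
  obtain ⟨v, hv, hv0⟩ := Matrix.exists_mulVec_eq_zero_iff.2 hdet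
  obtain ⟨D, rfl⟩ := Matrix.vec_bijective.surjective v
  refine hv (Matrix.vec_eq_zero_iff.2 (eq_zero_of_quadratic_eq_zero hP hS ?_))
  rw [frobSq_eq_dotProduct, frobSq_eq_dotProduct, ← dotProduct_normalMatrix_mulVec, hv0,
    dotProduct_zero]

/-- The filter returned by the closed-form least-squares solution for the operator `S`. -/
noncomputable def filterUpdate (P : Problem N M) (S : Mat N) : Mat N :=
  Matrix.of fun i j => ((P.normalMatrix S)⁻¹ *ᵥ ((P.X ⊗ₖ (1 : Mat N)) *ᵥ P.Y.vec)) (j, i)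

lemma vec_filterUpdate (P : Problem N M) (S : Mat N) :
    (P.filterUpdate S).vec = (P.normalMatrix S)⁻¹ *ᵥ ((P.X ⊗ₖ (1 : Mat N)) *ᵥ P.Y.vec) := rfl

lemma filterObjective_eq_filterUpdate_add {P : Problem N M} (hP : P.Admissible) {S : Mat N}
    (hS : ExcitesSimpleSpectrum P.X S) (H : Mat N) :
    P.filterObjective S H = P.filterObjective S (P.filterUpdate S)
      + (frobSq ((H - P.filterUpdate S) * P.X) + P.gam *
        frobSq (S * (H - P.filterUpdate S) - (H - P.filterUpdate S) * S)) := by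
  have hnorm : P.normalMatrix S *ᵥ (P.filterUpdate S).vec = (P.X ⊗ₖ (1 : Mat N)) *ᵥ P.Y.vec := by
    rw [vec_filterUpdate, Matrix.mulVec_mulVec,
      Matrix.mul_nonsing_inv _ (isUnit_det_normalMatrix hP hS), Matrix.one_mulVec]
  have h := P.filterObjective_add S (P.filterUpdate S) (H - P.filterUpdate S)
  rw [hnorm, sub_self, dotProduct_zero, mul_zero, add_zero, add_sub_cancel] at h
  exact h

lemma filterObjective_filterUpdate_le {P : Problem N M} (hP : P.Admissible) {S : Mat N}
    (hS : ExcitesSimpleSpectrum P.X S) (H : Mat N) :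
    P.filterObjective S (P.filterUpdate S) ≤ P.filterObjective S H := by
  rw [filterObjective_eq_filterUpdate_add hP hS H]
  exact le_add_of_nonneg_right
    (add_nonneg (frobSq_nonneg _) (mul_nonneg hP.gam_pos.le (frobSq_nonneg _)))

lemma eq_filterUpdate_of_filterObjective_eq {P : Problem N M} (hP : P.Admissible) {S : Mat N}
    (hS : ExcitesSimpleSpectrum P.X S) {H : Mat N}
    (h : P.filterObjective S H = P.filterObjective S (P.filterUpdate S)) :
    H = P.filterUpdate S := by
  rw [filterObjective_eq_filterUpdate_add hP hS H] at h
  exact sub_eq_zero.1 (eq_zero_of_quadratic_eq_zero hP hS (by linarith))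

/-! ### Continuity and closedness -/

lemma continuous_normalMatrix (P : Problem N M) : Continuous P.normalMatrix := by
  refine continuous_matrix fun i j => ?_
  simp only [normalMatrix, kronSum, Matrix.add_apply, Matrix.sub_apply, Matrix.smul_apply,
    Matrix.kroneckerMap_apply, Matrix.mul_apply, Matrix.transpose_apply]
  fun_prop

lemma continuousAt_filterUpdate {P : Problem N M} (hP : P.Admissible) {S : Mat N}
    (hS : ExcitesSimpleSpectrum P.X S) : ContinuousAt P.filterUpdate S := by
  have hinv : ContinuousAt (fun T => (P.normalMatrix T)⁻¹) S := by
    refine ContinuousAt.comp (g := Inv.inv) (continuousAt_matrix_inv _ ?_)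
      P.continuous_normalMatrix.continuousAt
    rw [Ring.inverse_eq_inv']
    exact continuousAt_inv₀ (isUnit_det_normalMatrix hP hS).ne_zero
  refine continuousAt_pi.2 fun i => continuousAt_pi.2 fun j => ?_
  have hcont : Continuous fun A : Matrix (Fin N × Fin N) (Fin N × Fin N) ℝ =>
      (A *ᵥ ((P.X ⊗ₖ (1 : Mat N)) *ᵥ P.Y.vec)) (j, i) := by fun_prop
  exact hcont.continuousAt.comp hinv

lemma continuous_filterObjective (P : Problem N M) {α : Type*} [TopologicalSpace α]
    {f g : α → Mat N} (hf : Continuous f) (hg : Continuous g) :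
    Continuous fun x => P.filterObjective (f x) (g x) := by
  unfold filterObjective
  have := @continuous_frobSq
  fun_prop

lemma continuous_penalty {P : Problem N M} (hP : P.Admissible) : Continuous P.penalty := by
  unfold penalty
  refine continuous_finsetSum _ fun i _ => continuous_finsetSum _ fun j _ => ?_
  refine ((Continuous.log (by fun_prop) fun S => ?_).const_mul _).add
    ((Continuous.log (by fun_prop) fun S => ?_).const_mul _)
  · exact (add_pos_of_nonneg_of_pos (abs_nonneg _) hP.δ₁_pos).ne'
  · exact (add_pos_of_nonneg_of_pos (abs_nonneg _) hP.δ₂_pos).ne'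

lemma continuous_objective {P : Problem N M} (hP : P.Admissible) : Continuous P.objective := by
  have h : P.objective = fun z => P.filterObjective z.2 z.1 + P.penalty z.2 :=
    funext fun z => P.objective_eq z.1 z.2
  rw [h]
  exact (P.continuous_filterObjective continuous_snd continuous_fst).add
    ((continuous_penalty hP).comp continuous_snd)

lemma continuous_denoisingObjective {P : Problem N M} (hP : P.Admissible) {α : Type*}
    [TopologicalSpace α] {f g h : α → Mat N} (hf : Continuous f) (hg : Continuous g)
    (hh : Continuous h) : Continuous fun x => P.denoisingObjective (f x) (g x) (h x) := by
  simp only [denoisingObjective_eq, weightedPenalty]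
  have hF := @continuous_frobSq N N
  refine Continuous.add ?_ (by fun_prop)
  refine continuous_finsetSum _ fun i _ => continuous_finsetSum _ fun j _ => ?_
  have h1 : Continuous fun x => 1 / (|g x i j - P.Sbar i j| + P.δ₁) :=
    continuous_const.div (by fun_prop) fun x =>
      (add_pos_of_nonneg_of_pos (abs_nonneg _) hP.δ₁_pos).ne'
  have h2 : Continuous fun x => 1 / (|g x i j| + P.δ₂) :=
    continuous_const.div (by fun_prop) fun x =>
      (add_pos_of_nonneg_of_pos (abs_nonneg _) hP.δ₂_pos).ne'
  fun_prop

lemma tendsto_denoisingObjective {P : Problem N M} (hP : P.Admissible) {f g h : ℕ → Mat N}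
    {A B C : Mat N} (hf : Tendsto f atTop (𝓝 A)) (hg : Tendsto g atTop (𝓝 B))
    (hh : Tendsto h atTop (𝓝 C)) :
    Tendsto (fun n => P.denoisingObjective (f n) (g n) (h n)) atTop
      (𝓝 (P.denoisingObjective A B C)) := by
  have hG : Continuous fun w : Mat N × Mat N × Mat N => P.denoisingObjective w.1 w.2.1 w.2.2 :=
    continuous_denoisingObjective hP continuous_fst (continuous_fst.comp continuous_snd)
      (continuous_snd.comp continuous_snd)
  have hlim := (hG.tendsto (A, B, C)).comp (hf.prodMk_nhds (hg.prodMk_nhds hh))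
  simpa only [Function.comp_def] using hlim

lemma continuous_stack : Continuous fun z : Mat N × Mat N => stack z.1 z.2 := by
  refine (PiLp.continuous_toLp 2 _).comp (continuous_pi fun k => ?_)
  rcases k with k | k <;> simp only [Sum.elim_inl, Sum.elim_inr, Matrix.vec] <;> fun_prop

lemma isClosed_setOf_isStationaryOn {P : Problem N M} (hP : P.Admissible) :
    IsClosed {z : Mat N × Mat N | IsStationaryOn P.objective (Set.univ ×ˢ P.feas) z} := by
  have heq : {z : Mat N × Mat N | IsStationaryOn P.objective (Set.univ ×ˢ P.feas) z} =
      Prod.snd ⁻¹' P.feas ∩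
        ((⋂ H', {z | P.filterObjective z.2 z.1 ≤ P.filterObjective z.2 H'}) ∩
          ⋂ T ∈ P.feas, {z | P.denoisingObjective z.1 z.2 z.2 ≤ P.denoisingObjective z.1 z.2 T}) := by
    ext ⟨H, S⟩
    rw [Set.mem_ofPred_eq, isStationaryOn_iff hP]
    simp only [Set.mem_inter_iff, Set.mem_preimage, Set.mem_iInter, Set.mem_ofPred_eq]
  rw [heq]
  refine (hP.feas_closed.preimage continuous_snd).inter (IsClosed.inter ?_ ?_)
  · exact isClosed_iInter fun H' =>
      isClosed_le (P.continuous_filterObjective continuous_snd continuous_fst)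
        (P.continuous_filterObjective continuous_snd continuous_const)
  · exact isClosed_iInter fun T => isClosed_iInter fun _ =>
      isClosed_le (continuous_denoisingObjective hP continuous_fst continuous_snd continuous_snd)
        (continuous_denoisingObjective hP continuous_fst continuous_snd continuous_const)

/-- The pair of matrices with a given stacked vector. -/
def unstack (w : EuclideanSpace ℝ ((Fin N × Fin N) ⊕ (Fin N × Fin N))) : Mat N × Mat N :=
  (Matrix.of fun i j => w (Sum.inl (j, i)), Matrix.of fun i j => w (Sum.inr (j, i)))

lemma stack_unstack (w : EuclideanSpace ℝ ((Fin N × Fin N) ⊕ (Fin N × Fin N))) :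
    stack (unstack w).1 (unstack w).2 = w := by
  ext k
  rcases k with k | k <;> rfl

lemma unstack_stack (H S : Mat N) : unstack (stack H S) = (H, S) := rfl

lemma continuous_unstack :
    Continuous (unstack : EuclideanSpace ℝ ((Fin N × Fin N) ⊕ (Fin N × Fin N)) → _) := by
  unfold unstack
  refine Continuous.prodMk ?_ ?_ <;> refine continuous_matrix fun i j => ?_ <;>
    simp only [Matrix.of_apply] <;> fun_prop

lemma isClosed_stationarySet {P : Problem N M} (hP : P.Admissible) :
    IsClosed P.stationarySet := by
  have heq : P.stationarySet = unstack ⁻¹'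
      {z | IsStationaryOn P.objective (Set.univ ×ˢ P.feas) z} := by
    ext w
    constructor
    · rintro ⟨H, S, rfl, h⟩
      rwa [Set.mem_preimage, unstack_stack]
    · intro h
      exact ⟨_, _, (stack_unstack w).symm, h⟩
  rw [heq]
  exact (isClosed_setOf_isStationaryOn hP).preimage continuous_unstack

end Problem
end RobustGF

namespace RobustGF
namespace Problem

variable {N M : ℕ}

/-! ### Descent and compactness -/

lemma isCompact_setOf_forall_abs_le (r : ℝ) : IsCompact {S : Mat N | ∀ i j, |S i j| ≤ r} := by
  have h : {S : Mat N | ∀ i j, |S i j| ≤ r} =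
      Set.univ.pi fun _ : Fin N => Set.univ.pi fun _ : Fin N => Set.Icc (-r) r := by
    ext S
    exact ⟨fun hS i _ j _ => abs_le.1 (hS i j),
      fun hS i j => abs_le.2 (hS i (Set.mem_univ i) j (Set.mem_univ j))⟩
  rw [h]
  exact isCompact_univ_pi fun _ => isCompact_univ_pi fun _ => isCompact_Icc

/-- The logarithms are bounded below by `log δ`, so a bound on their sum bounds each entry. -/
lemma exists_abs_le_of_penalty_le {P : Problem N M} (hP : P.Admissible) (c : ℝ) :
    ∃ r : ℝ, ∀ S : Mat N, P.penalty S ≤ c → ∀ i j, |S i j| ≤ r := by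
  set a := P.lam * Real.log P.δ₁
  set b := P.bet * Real.log P.δ₂
  refine ⟨Real.exp ((c - ∑ _i : Fin N, ∑ _j : Fin N, (a + b) + b) / P.bet), fun S hS i j => ?_⟩
  have hlog : ∀ (δ x : ℝ), 0 < δ → Real.log δ ≤ Real.log (|x| + δ) := fun δ x hδ =>
    Real.log_le_log hδ (le_add_of_nonneg_left (abs_nonneg x))
  have h1 : ∀ k l, a ≤ P.lam * Real.log (|S k l - P.Sbar k l| + P.δ₁) := fun k l =>
    mul_le_mul_of_nonneg_left (hlog _ _ hP.δ₁_pos) hP.lam_pos.le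
  have h2 : ∀ k l, b ≤ P.bet * Real.log (|S k l| + P.δ₂) := fun k l =>
    mul_le_mul_of_nonneg_left (hlog _ _ hP.δ₂_pos) hP.bet_pos.le
  -- The excess of each summand over its lower bound is at most the total excess.
  let e : Fin N → Fin N → ℝ := fun k l => P.lam * Real.log (|S k l - P.Sbar k l| + P.δ₁)
    + P.bet * Real.log (|S k l| + P.δ₂) - (a + b)
  have he : ∀ k l, 0 ≤ e k l := fun k l => by simp only [e]; linarith [h1 k l, h2 k l]
  have hsum : e i j ≤ P.penalty S - ∑ _i : Fin N, ∑ _j : Fin N, (a + b) := by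
    have h3 : e i j ≤ ∑ k, ∑ l, e k l :=
      (Finset.single_le_sum (f := fun l => e i l) (fun l _ => he i l) (Finset.mem_univ j)).trans
        (Finset.single_le_sum (f := fun k => ∑ l, e k l)
          (fun k _ => Finset.sum_nonneg fun l _ => he k l) (Finset.mem_univ i))
    refine h3.trans (le_of_eq ?_)
    simp only [e, penalty, Finset.sum_sub_distrib]
  have h4 : Real.log (|S i j| + P.δ₂) ≤
      (c - ∑ _i : Fin N, ∑ _j : Fin N, (a + b) + b) / P.bet := by
    rw [le_div_iff₀ hP.bet_pos]
    have : e i j = P.lam * Real.log (|S i j - P.Sbar i j| + P.δ₁)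
      + P.bet * Real.log (|S i j| + P.δ₂) - (a + b) := rfl
    linarith [h1 i j]
  have hpos : 0 < |S i j| + P.δ₂ := add_pos_of_nonneg_of_pos (abs_nonneg _) hP.δ₂_pos
  have h5 := (Real.log_le_iff_le_exp hpos).1 h4
  linarith [hP.δ₂_pos]

lemma filterObjective_nonneg {P : Problem N M} (hP : P.Admissible) (S H : Mat N) :
    0 ≤ P.filterObjective S H :=
  add_nonneg (frobSq_nonneg _) (mul_nonneg hP.gam_pos.le (frobSq_nonneg _))

namespace IsIteration

variable {P : Problem N M} {H S : ℕ → Mat N}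

lemma filter_eq (h : P.IsIteration H S) (t : ℕ) : H (t + 1) = P.filterUpdate (S t) :=
  Matrix.vec_inj.1 (h.filter_step t)

lemma objective_filter_step_le (hP : P.Admissible) (h : P.IsIteration H S)
    (hS : ∀ t, ExcitesSimpleSpectrum P.X (S t)) (t : ℕ) :
    P.objective (H (t + 2), S (t + 1)) ≤ P.objective (H (t + 1), S (t + 1)) := by
  rw [objective_eq, objective_eq, h.filter_eq (t + 1)]
  linarith [filterObjective_filterUpdate_le hP (hS (t + 1)) (H (t + 1))]

/-- The operator `S 0` may be infeasible, so the descent starts at the first computed operator. -/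
lemma objective_graph_step_le (hP : P.Admissible) (h : P.IsIteration H S) (t : ℕ) :
    P.objective (H (t + 2), S (t + 2)) ≤ P.objective (H (t + 2), S (t + 1)) := by
  have h1 := objective_sub_le hP (H (t + 2)) (S (t + 1)) (S (t + 2))
  have h2 := h.graph_step_min (t + 1) (h.graph_step_mem t)
  simp only [Set.mem_ofPred_eq] at h2
  linarith

lemma antitone_objective (hP : P.Admissible) (h : P.IsIteration H S)
    (hS : ∀ t, ExcitesSimpleSpectrum P.X (S t)) :
    Antitone fun t => P.objective (H (t + 1), S (t + 1)) :=
  antitone_nat_of_succ_le fun t =>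
    (h.objective_graph_step_le hP t).trans (h.objective_filter_step_le hP hS t)

lemma isCompact_closure_range (hP : P.Admissible) (h : P.IsIteration H S)
    (hS : ∀ t, ExcitesSimpleSpectrum P.X (S t)) : IsCompact (closure (Set.range S)) := by
  obtain ⟨r, hr⟩ := exists_abs_le_of_penalty_le hP
    (max (P.objective (H 1, S 1)) (P.penalty (S 0)))
  refine (isCompact_setOf_forall_abs_le r).closure_of_subset ?_
  rintro _ ⟨t, rfl⟩
  refine hr _ ?_
  cases t with
  | zero => exact le_max_right _ _
  | succ t =>
    refine le_max_of_le_left ?_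
    have h1 := h.antitone_objective hP hS (Nat.zero_le t)
    simp only [zero_add] at h1
    rw [objective_eq P (H (t + 1))] at h1
    linarith [filterObjective_nonneg hP (S (t + 1)) (H (t + 1))]

/-- If three consecutive operators converge along a subsequence, to `A`, `B`, `C`, then the filter
and the operator of the middle iterate converge to a stationary point. The objective takes the
same value at `(Ĥ(A), B)`, `(Ĥ(B), B)` and `(Ĥ(B), C)`, where `Ĥ` is the filter update. The first
equality gives `Ĥ(A) = Ĥ(B)` by uniqueness of the filter step, and the second shows that `B`
minimizes the majorizer built at `B`, because the limit `C` of the graph steps does. -/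
lemma mem_stationarySet_of_tendsto (hP : P.Admissible) (h : P.IsIteration H S)
    (hGSO : ∀ T ∈ closure (Set.range S), ExcitesSimpleSpectrum P.X T)
    {A B C : Mat N} {φ : ℕ → ℕ} (hφ : Tendsto φ atTop atTop)
    (hA : Tendsto (fun n => S (φ n)) atTop (𝓝 A))
    (hB : Tendsto (fun n => S (φ n + 1)) atTop (𝓝 B))
    (hC : Tendsto (fun n => S (φ n + 2)) atTop (𝓝 C)) :
    Tendsto (fun n => stack (H (φ n + 1)) (S (φ n + 1))) atTop (𝓝 (stack (P.filterUpdate A) B)) ∧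
      stack (P.filterUpdate A) B ∈ P.stationarySet := by
  have hS : ∀ t, ExcitesSimpleSpectrum P.X (S t) := fun t => hGSO _ (subset_closure ⟨t, rfl⟩)
  have hmem : ∀ {T : Mat N} {ψ : ℕ → ℕ}, Tendsto (fun n => S (ψ n)) atTop (𝓝 T) →
      ExcitesSimpleSpectrum P.X T := fun hT =>
    hGSO _ (mem_closure_of_tendsto hT (Eventually.of_forall fun n => ⟨_, rfl⟩))
  have hHA : Tendsto (fun n => H (φ n + 1)) atTop (𝓝 (P.filterUpdate A)) := by
    simp only [h.filter_eq]
    exact (continuousAt_filterUpdate hP (hmem hA)).tendsto.comp hA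
  have hHB : Tendsto (fun n => H (φ n + 2)) atTop (𝓝 (P.filterUpdate B)) := by
    simp only [h.filter_eq]
    exact (continuousAt_filterUpdate hP (hmem hB)).tendsto.comp hB
  have hobj := continuous_objective hP
  have lim₁ : Tendsto (fun n => P.objective (H (φ n + 1), S (φ n + 1))) atTop
      (𝓝 (P.objective (P.filterUpdate A, B))) := (hobj.tendsto _).comp (hHA.prodMk_nhds hB)
  have lim₂ : Tendsto (fun n => P.objective (H (φ n + 2), S (φ n + 1))) atTop
      (𝓝 (P.objective (P.filterUpdate B, B))) := (hobj.tendsto _).comp (hHB.prodMk_nhds hB)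
  have lim₃ : Tendsto (fun n => P.objective (H (φ n + 2), S (φ n + 2))) atTop
      (𝓝 (P.objective (P.filterUpdate B, C))) := (hobj.tendsto _).comp (hHB.prodMk_nhds hC)
  have le₁₂ : P.objective (P.filterUpdate B, B) ≤ P.objective (P.filterUpdate A, B) :=
    le_of_tendsto_of_tendsto' lim₂ lim₁ fun n => h.objective_filter_step_le hP hS (φ n)
  have le₂₃ : P.objective (P.filterUpdate B, C) ≤ P.objective (P.filterUpdate B, B) :=
    le_of_tendsto_of_tendsto' lim₃ lim₂ fun n => h.objective_graph_step_le hP (φ n)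
  -- The values at the middle iterates form a subsequence of an antitone sequence, so its limit
  -- bounds from below the values one step later.
  have le₃₁ : P.objective (P.filterUpdate A, B) ≤ P.objective (P.filterUpdate B, C) := by
    refine ge_of_tendsto' lim₃ fun n => ?_
    refine le_of_tendsto lim₁ ?_
    filter_upwards [hφ.eventually_ge_atTop (φ n + 1)] with m hm
    exact h.antitone_objective hP hS hm
  have hAB : P.filterUpdate A = P.filterUpdate B := by
    refine eq_filterUpdate_of_filterObjective_eq hP (hmem hB) ?_
    have h1 := le_antisymm le₁₂ (le₃₁.trans le₂₃)
    rw [objective_eq, objective_eq] at h1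
    linarith
  have hCmin : ∀ T ∈ P.feas, P.denoisingObjective (P.filterUpdate B) B C ≤
      P.denoisingObjective (P.filterUpdate B) B T := by
    intro T hT
    have l₁ := tendsto_denoisingObjective hP hHB hB hC
    have l₂ := tendsto_denoisingObjective hP hHB hB (tendsto_const_nhds (x := T))
    exact le_of_tendsto_of_tendsto' l₁ l₂ fun n => h.graph_step_min (φ n + 1) hT
  have hBC : P.denoisingObjective (P.filterUpdate B) B B ≤
      P.denoisingObjective (P.filterUpdate B) B C := by
    have h1 := objective_sub_le hP (P.filterUpdate B) B C
    linarith
  refine ⟨(continuous_stack.tendsto (P.filterUpdate A, B)).comp (hHA.prodMk_nhds hB),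
    _, _, rfl, (isStationaryOn_iff hP _ _).2 ⟨?_, ?_, ?_⟩⟩
  · exact hP.feas_closed.mem_of_tendsto hB (Eventually.of_forall fun n => h.graph_step_mem _)
  · rw [hAB]
    exact filterObjective_filterUpdate_le hP (hmem hB)
  · rw [hAB]
    exact fun T hT => hBC.trans (hCmin T hT)

/-- Every subsequence of the iterates has a further subsequence that converges to a stationary
point. -/
lemma exists_subseq_tendsto_stationary (hP : P.Admissible) (h : P.IsIteration H S)
    (hGSO : ∀ T ∈ closure (Set.range S), ExcitesSimpleSpectrum P.X T)
    {ns : ℕ → ℕ} (hns : Tendsto ns atTop atTop) :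
    ∃ (ms : ℕ → ℕ) (w : EuclideanSpace ℝ ((Fin N × Fin N) ⊕ (Fin N × Fin N))),
      w ∈ P.stationarySet ∧
        Tendsto (fun n => stack (H (ns (ms n) + 1)) (S (ns (ms n) + 1))) atTop (𝓝 w) := by
  have : FirstCountableTopology (Mat N) :=
    inferInstanceAs (FirstCountableTopology (Fin N → Fin N → ℝ))
  have hK := h.isCompact_closure_range hP fun t => hGSO _ (subset_closure ⟨t, rfl⟩)
  have hmem : ∀ t, S t ∈ closure (Set.range S) := fun t => subset_closure ⟨t, rfl⟩
  obtain ⟨⟨A, B, C⟩, -, ms, hms, hlim⟩ := (hK.prod (hK.prod hK)).tendsto_subseq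
    (x := fun n => (S (ns n), S (ns n + 1), S (ns n + 2)))
    fun n => ⟨hmem _, hmem _, hmem _⟩
  have hlim' := hlim.snd_nhds
  obtain ⟨h1, h2⟩ := h.mem_stationarySet_of_tendsto hP hGSO (φ := fun n => ns (ms n))
    (hns.comp hms.tendsto_atTop) hlim.fst_nhds hlim'.fst_nhds hlim'.snd_nhds
  exact ⟨ms, _, h2, h1⟩

end IsIteration
end Problem
end RobustGF

theorem theorem1 {N M : ℕ} (P : RobustGF.Problem N M) (hP : P.Admissible)
    (H S : ℕ → RobustGF.Mat N) (hHS : P.IsIteration H S)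
    (hGSO : ∀ T ∈ closure (Set.range S), RobustGF.ExcitesSimpleSpectrum P.X T) :
    ∃ d : ℕ → ℝ,
      (∀ t, IsLeast ((fun w => ‖RobustGF.stack (H t) (S t) - w‖) '' P.stationarySet) (d t)) ∧
      Tendsto d atTop (𝓝 0) := by
  have hclosed := RobustGF.Problem.isClosed_stationarySet hP
  have hne : P.stationarySet.Nonempty := by
    obtain ⟨-, w, hw, -⟩ := hHS.exists_subseq_tendsto_stationary hP hGSO tendsto_id
    exact ⟨w, hw⟩
  refine ⟨fun t => Metric.infDist (RobustGF.stack (H t) (S t)) P.stationarySet, fun t => ?_, ?_⟩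
  · obtain ⟨w, hw, hdist⟩ := hclosed.exists_infDist_eq_dist hne (RobustGF.stack (H t) (S t))
    refine ⟨⟨w, hw, (dist_eq_norm _ _).symm.trans hdist.symm⟩, ?_⟩
    rintro _ ⟨v, hv, rfl⟩
    exact (Metric.infDist_le_dist_of_mem hv).trans_eq (dist_eq_norm _ _)
  · refine (tendsto_add_atTop_iff_nat 1).1 (tendsto_of_subseq_tendsto fun ns hns => ?_)
    obtain ⟨ms, w, hw, hlim⟩ := hHS.exists_subseq_tendsto_stationary hP hGSO hns
    refine ⟨ms, ?_⟩
    have h0 := ((Metric.continuous_infDist_pt P.stationarySet).tendsto w).comp hlim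
    rwa [Metric.infDist_zero_of_mem hw] at h0
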